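/- Let $n, p$ be non-negative integers. For real matrices $A \in \mathbb{R}^{n\times n}$, $B\in\mathbb{R}^{n\times m}$ and $c \in \mathbb{R}^{n\times p}$, the pair $(A,B)$ is called controllable if the controllability matrix $[B, AB, \dots, A^{n-1}B]$ has rank $n$, and the pair $(A,c)$ is called observable if the matrix with block rows $c^\top, c^\top A, \dots, c^\top A^{n-1}$ has rank $n$. Let $\mathcal{X}$ be the set of triplets $(A,c,P)$ with $A \in \mathbb{R}^{n\times n}$, $c \in \mathbb{R}^{n\times p}$, $(A,c)$ observable and $P\in\mathbb{R}^{n\times n}$ symmetric positive definite, equipped with the subspace topology inherited from $\mathbb{R}^{n\times n}\times\mathbb{R}^{n\times p}\times\mathbb{R}^{n\times n}$. A triplet $(A,c,P)\in\mathcal{X}$ is called regular if there is a number $r>0$ such that the pair $(A,\Sigma c)$ is controllable, where $\Sigma$ is the unique symmetric positive definite solution of the algebraic Riccati equation $$A\Sigma+\Sigma A^\top - r\,\Sigma c c^\top \Sigma + P = 0.$$ Let $\mathcal{X}_{\rm reg}\subset\mathcal{X}$ be the set of regular triplets. Then $\mathcal{X}_{\rm reg}$ is open and dense in $\mathcal{X}$.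 -/

import Mathlib

/-- The controllability matrix `[B, A B, …, A ^ (n - 1) B]` of a pair `(A, B)`. -/
def controllabilityMatrix {n m : ℕ} (A : Matrix (Fin n) (Fin n) ℝ)
    (B : Matrix (Fin n) (Fin m) ℝ) : Matrix (Fin n) (Fin n × Fin m) ℝ :=
  Matrix.of fun i q => (A ^ (q.1 : ℕ) * B) i q.2

/-- The pair `(A, B)`, i.e. the system `x' = A x + B u`, is controllable: its controllability
matrix has full rank. -/
def IsControllablePair {n m : ℕ} (A : Matrix (Fin n) (Fin n) ℝ)
    (B : Matrix (Fin n) (Fin m) ℝ) : Prop :=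
  (controllabilityMatrix A B).rank = n

/-- The observability matrix, with blocks `cᵀ, cᵀ A, …, cᵀ A ^ (n - 1)`, of the system
`x' = A x`, `y = cᵀ x`. The columns of `c` are the observation vectors. -/
def observabilityMatrix {n p : ℕ} (A : Matrix (Fin n) (Fin n) ℝ)
    (c : Matrix (Fin n) (Fin p) ℝ) : Matrix (Fin n × Fin p) (Fin n) ℝ :=
  Matrix.of fun q i => (c.transpose * A ^ (q.1 : ℕ)) q.2 i

/-- The pair `(A, c)`, i.e. the system `x' = A x`, `y = cᵀ x`, is observable: its observability
matrix has full rank. -/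
def IsObservablePair {n p : ℕ} (A : Matrix (Fin n) (Fin n) ℝ)
    (c : Matrix (Fin n) (Fin p) ℝ) : Prop :=
  (observabilityMatrix A c).rank = n

/-- `S` is a positive definite (in particular symmetric) solution of the algebraic Riccati
equation `A S + S Aᵀ - r S c cᵀ S + P = 0`. -/
def IsPosDefRiccatiSolution {n p : ℕ} (A : Matrix (Fin n) (Fin n) ℝ)
    (c : Matrix (Fin n) (Fin p) ℝ) (P : Matrix (Fin n) (Fin n) ℝ) (r : ℝ)
    (S : Matrix (Fin n) (Fin n) ℝ) : Prop :=
  S.PosDef ∧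
    A * S + S * A.transpose - r • (S * c * c.transpose * S) + P = 0

/-- The triplets `(A, c, P)` with `(A, c)` observable and `P` positive definite. -/
def observableTriplets (n p : ℕ) :
    Set (Matrix (Fin n) (Fin n) ℝ × Matrix (Fin n) (Fin p) ℝ × Matrix (Fin n) (Fin n) ℝ) :=
  {x | IsObservablePair x.1 x.2.1 ∧ x.2.2.PosDef}

/-- The regular triplets `(A, c, P)`: `(A, c)` is observable, `P` is positive definite, and for
some `r > 0` the pair `(A, S c)` is controllable, where `S` is the unique positive definite
solution of the Riccati equation. -/
def regularTriplets (n p : ℕ) :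
    Set (Matrix (Fin n) (Fin n) ℝ × Matrix (Fin n) (Fin p) ℝ × Matrix (Fin n) (Fin n) ℝ) :=
  {x | x ∈ observableTriplets n p ∧
    ∃ r : ℝ, 0 < r ∧ ∃ S : Matrix (Fin n) (Fin n) ℝ,
      IsPosDefRiccatiSolution x.1 x.2.1 x.2.2 r S ∧
      (∀ T, IsPosDefRiccatiSolution x.1 x.2.1 x.2.2 r T → T = S) ∧
      IsControllablePair x.1 (S * x.2.1)}

/-!
Passing to the closed loops `A - S * C` turns the difference of two solutions of a Riccati equation
into a solution of a Sylvester equation `M * D + D * Nᴴ = 0` in which `M` and `N` are stable, with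
the solutions themselves as Lyapunov certificates. Hence `D = 0`: positive definite solutions are
unique. The derivative of the equation in the unknown is an operator of the same kind, so by the
open mapping form of the inverse function theorem solutions persist, arbitrarily close by, under
perturbation of the data. This gives openness of the regular triplets.

Existence is by continuation. Solvability is an open condition on the data, and it is closed because
observability forbids a nonzero direction along which solutions could escape to infinity. Moreover
`S = 1` solves an equation in which `A` is shifted by a large multiple of the identity.

For density, start from the solution `S` for `(A, c, P)` with `r = 1`, move `(A, S)` along the
segment towards `(Aᵀ, 1)`, and let the Riccati equation define `P` along the way. At the far end the
pair `(Aᵀ, 1 * c)` is controllable by observability of `(A, c)`. The determinant of the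
controllability Gramian is a polynomial in the parameter, so the pair is controllable for all but
finitely many parameters, in particular arbitrarily close to the start.
-/

open Matrix Filter Topology
open scoped ComplexOrder

section PositiveMatrices

variable {ι κ 𝕜 : Type*} [RCLike 𝕜]

theorem convex_setOf_posDef : Convex ℝ {M : Matrix ι ι 𝕜 | M.PosDef} := by
  refine convex_iff_forall_pos.mpr fun M hM N hN a b ha hb _ => ?_
  exact (PosDef.smul hM ha).add (hN.smul hb)

section Fintype

variable [Fintype ι]

theorem posDef_iff_re_dotProduct_pos {M : Matrix ι ι 𝕜} (hM : M.IsHermitian) :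
    M.PosDef ↔ ∀ v : ι → 𝕜, v ≠ 0 → 0 < RCLike.re (star v ⬝ᵥ M *ᵥ v) := by
  refine ⟨fun h v hv => h.re_dotProduct_pos hv, fun h => .of_dotProduct_mulVec_pos hM ?_⟩
  exact fun v hv => RCLike.pos_iff.mpr ⟨h v hv, hM.im_star_dotProduct_mulVec_self v⟩

theorem mul_eq_zero_of_conjTranspose_mul_mul_eq_zero {M : Matrix ι ι 𝕜} (hM : M.PosSemidef)
    {V : Matrix ι κ 𝕜} (h : Vᴴ * M * V = 0) : M * V = 0 := by
  ext i j
  have hj : star (V.col j) ⬝ᵥ M *ᵥ V.col j = 0 := by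
    rw [Matrix.mul_assoc] at h
    exact congrFun₂ h j j
  exact congrFun ((hM.dotProduct_mulVec_zero_iff _).mp hj) i

theorem eq_zero_of_conjTranspose_mul_mul_eq_zero {M : Matrix ι ι 𝕜} (hM : M.PosDef)
    {V : Matrix ι κ 𝕜} (h : Vᴴ * M * V = 0) : V = 0 := by
  classical
  rw [← nonsing_inv_mul_cancel_left _ V ((isUnit_iff_isUnit_det M).mp hM.isUnit),
    mul_eq_zero_of_conjTranspose_mul_mul_eq_zero hM.posSemidef h, Matrix.mul_zero]

theorem star_vecMul_eq_zero {R : Type*} [NonUnitalSemiring R] [StarRing R] {M : Matrix ι ι R}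
    (hM : M.IsHermitian) {v : ι → R} (h : M *ᵥ v = 0) : star v ᵥ* M = 0 := by
  rw [← hM.eq, vecMul_conjTranspose, star_star, h, star_zero]

end Fintype

variable [Finite ι]

theorem isClosed_setOf_posSemidef : IsClosed {M : Matrix ι ι 𝕜 | M.PosSemidef} := by
  cases nonempty_fintype ι
  simp only [posSemidef_iff_dotProduct_mulVec, IsHermitian, Set.ofPred_and, Set.ofPred_forall]
  refine (isClosed_eq (by fun_prop) (by fun_prop)).inter (isClosed_iInter fun v => ?_)
  exact isClosed_le (by fun_prop) (by fun_prop)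

theorem eventually_posDef {M : Matrix ι ι 𝕜} (hM : M.PosDef) :
    ∀ᶠ T in 𝓝 M, T.IsHermitian → T.PosDef := by
  cases nonempty_fintype ι
  have hpos : ∀ᶠ T in 𝓝 M, ∀ v ∈ Metric.sphere (0 : ι → 𝕜) 1,
      0 < RCLike.re (star v ⬝ᵥ T *ᵥ v) := by
    refine (isCompact_sphere _ _).eventually_forall_of_forall_eventually fun v hv => ?_
    refine ContinuousAt.eventually_lt (f := fun _ => (0 : ℝ)) continuousAt_const
      (g := fun z : Matrix ι ι 𝕜 × (ι → 𝕜) => RCLike.re (star z.2 ⬝ᵥ z.1 *ᵥ z.2))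
      (RCLike.continuous_re.comp (by fun_prop)).continuousAt ?_
    exact hM.re_dotProduct_pos (ne_zero_of_mem_unit_sphere ⟨v, hv⟩)
  filter_upwards [hpos] with T hT hTH
  refine (posDef_iff_re_dotProduct_pos hTH).mpr fun v hv => ?_
  have hunit := hT (‖v‖⁻¹ • v) (by simp [norm_smul, hv])
  simpa [star_smul, mulVec_smul, RCLike.smul_re, hv] using hunit

variable [DecidableEq ι]

theorem exists_posDef_add_smul_one {H : Matrix ι ι 𝕜} (hH : H.IsHermitian) :
    ∃ s : ℝ, (H + s • (1 : Matrix ι ι 𝕜)).PosDef := by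
  have hlim : Tendsto (fun t : ℝ => (1 : Matrix ι ι 𝕜) + t • H) (𝓝[>] 0) (𝓝 1) := by
    refine Tendsto.mono_left (Continuous.tendsto' (by fun_prop) _ _ ?_) nhdsWithin_le_nhds
    simp
  obtain ⟨t, htpos, ht : 0 < t⟩ :=
    ((hlim.eventually (eventually_posDef .one)).and self_mem_nhdsWithin).exists
  have hsmul := (htpos (isHermitian_one.add (hH.smul (.all t)))).smul (inv_pos.mpr ht)
  refine ⟨t⁻¹, ?_⟩
  rwa [smul_add, smul_smul, inv_mul_cancel₀ ht.ne', one_smul, add_comm] at hsmul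

end PositiveMatrices

section Sylvester

variable {ι κ 𝕜 : Type*} [Fintype ι] [Fintype κ] [RCLike 𝕜]

theorem exists_eq_conjTranspose_mul_self {M : Matrix ι ι 𝕜} (hM : M.PosSemidef) :
    ∃ L : Matrix ι ι 𝕜, M = Lᴴ * L := by
  classical
  open scoped MatrixOrder in
  exact CStarAlgebra.nonneg_iff_eq_star_mul_self.mp hM.nonneg

theorem trace_mul_nonneg {M N : Matrix ι ι 𝕜} (hM : M.PosSemidef) (hN : N.PosSemidef) :
    0 ≤ (M * N).trace := by
  obtain ⟨L, rfl⟩ := exists_eq_conjTranspose_mul_self hN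
  rw [← Matrix.mul_assoc, trace_mul_comm, ← Matrix.mul_assoc]
  exact (hM.mul_mul_conjTranspose_same L).trace_nonneg

theorem eq_zero_of_trace_mul_eq_zero {M N : Matrix ι ι 𝕜} (hM : M.PosSemidef) (hN : N.PosDef)
    (h : (M * N).trace = 0) : M = 0 := by
  classical
  obtain ⟨L, hL⟩ := exists_eq_conjTranspose_mul_self hN.posSemidef
  rw [hL, ← Matrix.mul_assoc, trace_mul_comm, ← Matrix.mul_assoc,
    (hM.mul_mul_conjTranspose_same L).trace_eq_zero_iff] at h
  have hML : M * Lᴴ = 0 :=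
    mul_eq_zero_of_conjTranspose_mul_mul_eq_zero hM (by rwa [conjTranspose_conjTranspose])
  refine hN.isUnit.mul_left_eq_zero.mp ?_
  rw [hL, ← Matrix.mul_assoc, hML, Matrix.zero_mul]

/-- A Lyapunov certificate for the stability of `Mᴴ`: a positive definite matrix `S` for which
`M * S + S * Mᴴ` is negative definite. -/
structure IsLyapunovCertificate (M S : Matrix ι ι 𝕜) : Prop where
  posDef : S.PosDef
  posDef_neg : (-(M * S + S * Mᴴ)).PosDef

theorem trace_sylvester {R : Type*} [CommRing R] [StarRing R] {M S : Matrix ι ι R}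
    {N T : Matrix κ κ R} (F : Matrix ι κ R) (hS : S.IsHermitian) (hT : T.IsHermitian) :
    (Fᴴ * (M * S + S * Mᴴ) * F * T).trace + (Fᴴ * S * F * (N * T + T * Nᴴ)).trace
      = (Fᴴ * (M * (S * F * T) + S * F * T * Nᴴ)).trace
        + (F * (M * (S * F * T) + S * F * T * Nᴴ)ᴴ).trace := by
  have hcycle : (Fᴴ * S * Mᴴ * F * T).trace = (F * (T * Fᴴ * S * Mᴴ)).trace := by
    rw [trace_mul_comm F, trace_mul_comm _ T]
    simp only [Matrix.mul_assoc]
  have hcycle' : (Fᴴ * S * F * N * T).trace = (F * (N * T * Fᴴ * S)).trace := by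
    rw [Matrix.mul_assoc _ F N, Matrix.mul_assoc _ (F * N) T, trace_mul_comm]
    simp only [Matrix.mul_assoc]
  simp only [conjTranspose_add, conjTranspose_mul, conjTranspose_conjTranspose, hS.eq, hT.eq,
    Matrix.mul_add, Matrix.add_mul, trace_add, ← Matrix.mul_assoc] at hcycle hcycle' ⊢
  rw [hcycle, hcycle']
  ring

theorem sylvester_eq_zero {M S : Matrix ι ι 𝕜} {N T : Matrix κ κ 𝕜} {D : Matrix ι κ 𝕜}
    (hM : IsLyapunovCertificate M S) (hN : IsLyapunovCertificate N T)
    (h : M * D + D * Nᴴ = 0) : D = 0 := by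
  classical
  -- Writing `D = S * F * T` and pairing `M * D + D * Nᴴ` with `F` gives a sum of two traces, each
  -- of a fixed sign by the Lyapunov inequalities.
  have hS : IsUnit S.det := (isUnit_iff_isUnit_det S).mp hM.posDef.isUnit
  have hT : IsUnit T.det := (isUnit_iff_isUnit_det T).mp hN.posDef.isUnit
  obtain ⟨F, rfl⟩ : ∃ F, D = S * F * T := ⟨S⁻¹ * D * T⁻¹, by
    rw [← Matrix.mul_assoc, mul_nonsing_inv_cancel_left _ _ hS,
      nonsing_inv_mul_cancel_right _ _ hT]⟩
  have hQ := hM.posDef_neg.posSemidef.conjTranspose_mul_mul_same F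
  have hnonneg := trace_mul_nonneg hQ hN.posDef.posSemidef
  have hnonneg' := trace_mul_nonneg (hM.posDef.posSemidef.conjTranspose_mul_mul_same F)
    hN.posDef_neg.posSemidef
  have hsum : (Fᴴ * -(M * S + S * Mᴴ) * F * T).trace
      + (Fᴴ * S * F * -(N * T + T * Nᴴ)).trace = 0 := by
    have htrace := trace_sylvester (M := M) (N := N) F hM.posDef.isHermitian hN.posDef.isHermitian
    rw [h, conjTranspose_zero, Matrix.mul_zero, Matrix.mul_zero, trace_zero, trace_zero] at htrace
    simp only [Matrix.mul_neg, Matrix.neg_mul, trace_neg]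
    linear_combination -htrace
  have hF : F = 0 := eq_zero_of_conjTranspose_mul_mul_eq_zero hM.posDef_neg <|
    eq_zero_of_trace_mul_eq_zero hQ hN.posDef
      ((add_eq_zero_iff_of_nonneg hnonneg hnonneg').mp hsum).1
  rw [hF, Matrix.mul_zero, Matrix.zero_mul]

end Sylvester

section OpenMapping

theorem map_nhds_eq_of_injective_fderiv {E : Type*} [NormedAddCommGroup E] [NormedSpace ℝ E]
    [FiniteDimensional ℝ E] {f : E → E} {f' : E →L[ℝ] E} {x : E} (hf : HasStrictFDerivAt f f' x)
    (hf' : ∀ v, f' v = 0 → v = 0) : map f (𝓝 x) = 𝓝 (f x) := by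
  have : CompleteSpace E := FiniteDimensional.complete ℝ E
  exact hf.map_nhds_eq_of_surj
    (LinearMap.ker_eq_bot_iff_range_eq_top.mp (LinearMap.ker_eq_bot'.mpr hf'))

theorem map_nhds_riccati {R : Type*} [NormedRing R] [NormedAlgebra ℝ R] [FiniteDimensional ℝ R]
    [StarRing R] [StarModule ℝ R] {A C S : R}
    (h : ∀ V, V * C * S + S * C * V - A * V - V * star A = 0 → V = 0) :
    map (fun x : R × R × R =>
      (x.1, x.2.1, x.2.2 * x.2.1 * x.2.2 - x.1 * x.2.2 - x.2.2 * star x.1)) (𝓝 (A, C, S))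
      = 𝓝 (A, C, S * C * S - A * S - S * star A) := by
  set z : R × R × R := (A, C, S)
  let starL : R →L[ℝ] R := LinearMap.toContinuousLinearMap (starLinearEquiv ℝ (A := R)).toLinearMap
  have hstar (x : R) : starL x = star x := rfl
  have hA := hasStrictFDerivAt_fst (𝕜 := ℝ) (p := z)
  have hC := hasStrictFDerivAt_fst.comp z (hasStrictFDerivAt_snd (𝕜 := ℝ) (p := z))
  have hS := hasStrictFDerivAt_snd.comp z (hasStrictFDerivAt_snd (𝕜 := ℝ) (p := z))
  have hAstar := starL.hasStrictFDerivAt.comp z hA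
  have hderiv := ((hS.mul' hC).mul' hS).sub (hA.mul' hS) |>.sub (hS.mul' hAstar)
  refine map_nhds_eq_of_injective_fderiv (hA.prodMk (hC.prodMk hderiv)) ?_
  rintro ⟨a, c, V⟩ hv
  obtain ⟨rfl, rfl, hV⟩ : a = 0 ∧ c = 0 ∧ _ := by simpa [Prod.ext_iff] using hv
  rw [h V, Prod.mk_zero_zero, Prod.mk_zero_zero]
  rw [← hV]
  simp only [hstar, star_zero, mul_zero, zero_mul, zero_add]
  abel

end OpenMapping

section Riccati

section Ring

variable {ι R : Type*} [Fintype ι] [NonUnitalRing R] [StarRing R] {A C S T : Matrix ι ι R}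

/-- The quadratic map whose level sets are the algebraic Riccati equations: the equation
`A * S + S * Aᴴ - S * C * S + P = 0` reads `riccatiMap A C S = P`. -/
def riccatiMap (A C S : Matrix ι ι R) : Matrix ι ι R :=
  S * C * S - A * S - S * Aᴴ

theorem riccatiMap_conjTranspose (hC : C.IsHermitian) :
    riccatiMap A C Sᴴ = (riccatiMap A C S)ᴴ := by
  simp only [riccatiMap, conjTranspose_sub, conjTranspose_mul, conjTranspose_conjTranspose, hC.eq,
    Matrix.mul_assoc]
  abel

theorem continuous_riccatiMap [TopologicalSpace R] [IsTopologicalRing R] [ContinuousStar R] :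
    Continuous fun x : Matrix ι ι R × Matrix ι ι R × Matrix ι ι R =>
      riccatiMap x.1 x.2.1 x.2.2 := by
  unfold riccatiMap
  fun_prop

theorem riccatiMap_sub_riccatiMap (hC : C.IsHermitian) :
    riccatiMap A C T - riccatiMap A C S
      = (A - S * C) * (S - T) + (S - T) * (A - Tᴴ * C)ᴴ := by
  simp only [riccatiMap, conjTranspose_sub, conjTranspose_mul, conjTranspose_conjTranspose, hC.eq]
  noncomm_ring

end Ring

variable {ι 𝕜 : Type*} [Fintype ι] [RCLike 𝕜] {A C S T : Matrix ι ι 𝕜}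

theorem isLyapunovCertificate_closedLoop (hC : C.PosSemidef) (hS : S.PosDef)
    (hP : (riccatiMap A C S).PosDef) : IsLyapunovCertificate (A - S * C) S := by
  refine ⟨hS, ?_⟩
  have hSCS := hC.conjTranspose_mul_mul_same S
  convert hP.add_posSemidef hSCS using 1
  simp only [riccatiMap, conjTranspose_sub, conjTranspose_mul, hC.isHermitian.eq,
    hS.isHermitian.eq]
  noncomm_ring

theorem eq_of_riccatiMap_eq (hC : C.PosSemidef) (hS : S.PosDef) (hT : T.PosDef)
    (hP : (riccatiMap A C S).PosDef) (h : riccatiMap A C T = riccatiMap A C S) : T = S := by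
  have hdiff := riccatiMap_sub_riccatiMap (A := A) (S := S) (T := T) hC.isHermitian
  rw [h, sub_self, hT.isHermitian.eq] at hdiff
  exact (sub_eq_zero.mp (sylvester_eq_zero (isLyapunovCertificate_closedLoop hC hS hP)
    (isLyapunovCertificate_closedLoop hC hT (h ▸ hP)) hdiff.symm)).symm

theorem isHermitian_of_isHermitian_riccatiMap (hC : C.IsHermitian)
    (hS : IsLyapunovCertificate (A - T * C) S) (hT : (riccatiMap A C T).IsHermitian) :
    T.IsHermitian := by
  have hdiff := riccatiMap_sub_riccatiMap (A := A) (S := T) (T := Tᴴ) hC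
  rw [riccatiMap_conjTranspose hC, hT.eq, sub_self, conjTranspose_conjTranspose] at hdiff
  exact (sub_eq_zero.mp (sylvester_eq_zero hS hS hdiff.symm)).symm

theorem map_nhds_riccatiMap (hC : C.IsHermitian) (hS : IsLyapunovCertificate (A - S * C) S) :
    map (fun x : Matrix ι ι 𝕜 × Matrix ι ι 𝕜 × Matrix ι ι 𝕜 =>
      (x.1, x.2.1, riccatiMap x.1 x.2.1 x.2.2)) (𝓝 (A, C, S)) = 𝓝 (A, C, riccatiMap A C S) := by
  classical
  open scoped Matrix.Norms.Operator in
  refine map_nhds_riccati fun V hV => sylvester_eq_zero hS hS ?_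
  rw [conjTranspose_sub, conjTranspose_mul, hS.posDef.isHermitian.eq, hC.eq, ← neg_eq_zero, ← hV,
    star_eq_conjTranspose]
  noncomm_ring

theorem eventually_isLyapunovCertificate {M : Matrix ι ι 𝕜} (h : IsLyapunovCertificate M S) :
    ∀ᶠ N in 𝓝 M, IsLyapunovCertificate N S := by
  have hcont : Continuous fun N : Matrix ι ι 𝕜 => -(N * S + S * Nᴴ) := by fun_prop
  filter_upwards [hcont.continuousAt.eventually (eventually_posDef h.posDef_neg)] with N hN
  refine ⟨h.posDef, hN ?_⟩
  rw [IsHermitian, conjTranspose_neg, conjTranspose_add, conjTranspose_mul, conjTranspose_mul,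
    conjTranspose_conjTranspose, h.posDef.isHermitian.eq, add_comm]

theorem eventually_exists_riccatiMap_eq (hC : C.PosSemidef) (hS : S.PosDef)
    (hP : (riccatiMap A C S).PosDef) {U : Set (Matrix ι ι 𝕜)} (hU : U ∈ 𝓝 S) :
    ∀ᶠ x in 𝓝 (A, C, riccatiMap A C S), x.2.1.IsHermitian → x.2.2.IsHermitian →
      ∃ T ∈ U, T.PosDef ∧ riccatiMap x.1 x.2.1 T = x.2.2 := by
  have hcert := isLyapunovCertificate_closedLoop hC hS hP
  have hsnd : Tendsto (fun x : Matrix ι ι 𝕜 × Matrix ι ι 𝕜 × Matrix ι ι 𝕜 => x.2.2)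
      (𝓝 (A, C, S)) (𝓝 S) := (by fun_prop : Continuous _).tendsto _
  have hloop : Tendsto
      (fun x : Matrix ι ι 𝕜 × Matrix ι ι 𝕜 × Matrix ι ι 𝕜 => x.1 - x.2.2 * x.2.1)
      (𝓝 (A, C, S)) (𝓝 (A - S * C)) := (by fun_prop : Continuous _).tendsto _
  rw [← map_nhds_riccatiMap hC.isHermitian hcert, eventually_map]
  filter_upwards [hsnd hU, hsnd.eventually (eventually_posDef hS),
    hloop.eventually (eventually_isLyapunovCertificate hcert)] with x hxU hxpos hxcert hxC hxP
  exact ⟨x.2.2, hxU, hxpos (isHermitian_of_isHermitian_riccatiMap hxC hxcert hxP), rfl⟩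

end Riccati

section Reachability

variable {ι κ R : Type*} [Fintype ι] [Fintype κ]

/-- Reachability of the system `x' = A x + B u`, in geometric form: no proper `A`-invariant
subspace contains the range of `B`. -/
def IsReachable [CommRing R] (A : Matrix ι ι R) (B : Matrix ι κ R) : Prop :=
  ∀ W : Submodule R (ι → R), (∀ v ∈ W, A *ᵥ v ∈ W) → (∀ u, B *ᵥ u ∈ W) → W = ⊤

theorem IsReachable.sub_smul_one [CommRing R] [DecidableEq ι] {A : Matrix ι ι R}
    {B : Matrix ι κ R} (h : IsReachable A B) (s : R) : IsReachable (A - s • 1) B := by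
  refine fun W hA hB => h W (fun v hv => ?_) hB
  simpa [sub_mulVec, smul_mulVec] using W.add_mem (hA v hv) (W.smul_mem s hv)

theorem IsReachable.mul_conjTranspose [RCLike R] {A : Matrix ι ι R}
    {B : Matrix ι κ R} (h : IsReachable A B) : IsReachable A (B * Bᴴ) := by
  classical
  have hrange : LinearMap.range (B * Bᴴ).mulVecLin = LinearMap.range B.mulVecLin := by
    refine Submodule.eq_of_le_of_finrank_eq ?_ (rank_self_mul_conjTranspose B)
    rw [mulVecLin_mul]
    exact LinearMap.range_comp_le_range _ _
  refine fun W hA hB => h W hA fun u => ?_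
  obtain ⟨w, hw⟩ := hrange.ge ⟨u, rfl⟩
  have hu : (B * Bᴴ) *ᵥ w = B *ᵥ u := hw
  exact hu ▸ hB w

end Reachability

section Continuation

variable {ι 𝕜 : Type*} [Fintype ι] [RCLike 𝕜] {A C P S : Matrix ι ι 𝕜}

theorem posDef_of_posDef_riccatiMap (hS : S.PosSemidef) (hP : (riccatiMap A C S).PosDef) :
    S.PosDef := by
  refine .of_dotProduct_mulVec_pos hS.isHermitian fun v hv => ?_
  refine (hS.dotProduct_mulVec_nonneg v).lt_of_ne' fun h => ?_
  have hker : S *ᵥ v = 0 := (hS.dotProduct_mulVec_zero_iff v).mp h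
  have hker' : star v ᵥ* S = 0 := star_vecMul_eq_zero hS.isHermitian hker
  simpa [riccatiMap, sub_mulVec, ← mulVec_mulVec, hker, dotProduct_mulVec _ S, hker']
    using hP.dotProduct_mulVec_pos hv

/-- The pairs `z = (s, Z)` such that `s⁻¹ • Z` is a positive semidefinite solution of
`riccatiMap A C S = P` when `0 < s`, with the denominator cleared so that they form a closed cone.
The case `s = 0` describes the possible directions of escape to infinity of the solutions. -/
structure IsHomogeneousSolution (A C P : Matrix ι ι 𝕜) (z : ℝ × Matrix ι ι 𝕜) : Prop where
  nonneg : 0 ≤ z.1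
  posSemidef : z.2.PosSemidef
  posSemidef_lyapunov : (A * z.2 + z.2 * Aᴴ + z.1 • P).PosSemidef
  mul_mul_self : z.2 * C * z.2 = z.1 • (A * z.2 + z.2 * Aᴴ + z.1 • P)

theorem IsHomogeneousSolution.smul {z : ℝ × Matrix ι ι 𝕜} (h : IsHomogeneousSolution A C P z)
    {t : ℝ} (ht : 0 ≤ t) : IsHomogeneousSolution A C P (t • z) := by
  have hlyap : A * (t • z.2) + (t • z.2) * Aᴴ + (t * z.1) • P
      = t • (A * z.2 + z.2 * Aᴴ + z.1 • P) := by
    simp only [Matrix.mul_smul, Matrix.smul_mul, smul_add, mul_smul]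
  refine ⟨mul_nonneg ht h.nonneg, h.posSemidef.smul ht, ?_, ?_⟩
  · exact hlyap.symm ▸ h.posSemidef_lyapunov.smul ht
  · change (t • z.2) * C * (t • z.2) = (t * z.1) • (A * (t • z.2) + (t • z.2) * Aᴴ + (t * z.1) • P)
    rw [hlyap, Matrix.smul_mul, Matrix.smul_mul, Matrix.mul_smul, h.mul_mul_self]
    module

theorem isClosed_setOf_isHomogeneousSolution :
    IsClosed {x : (Matrix ι ι 𝕜 × Matrix ι ι 𝕜 × Matrix ι ι 𝕜) × ℝ × Matrix ι ι 𝕜 |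
      IsHomogeneousSolution x.1.1 x.1.2.1 x.1.2.2 x.2} := by
  have hset : {x : (Matrix ι ι 𝕜 × Matrix ι ι 𝕜 × Matrix ι ι 𝕜) × ℝ × Matrix ι ι 𝕜 |
      IsHomogeneousSolution x.1.1 x.1.2.1 x.1.2.2 x.2} =
      {x | 0 ≤ x.2.1} ∩ {x | x.2.2.PosSemidef} ∩
      {x | (x.1.1 * x.2.2 + x.2.2 * x.1.1ᴴ + x.2.1 • x.1.2.2).PosSemidef} ∩
      {x | x.2.2 * x.1.2.1 * x.2.2
        = x.2.1 • (x.1.1 * x.2.2 + x.2.2 * x.1.1ᴴ + x.2.1 • x.1.2.2)} := by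
    ext x
    exact ⟨fun h => ⟨⟨⟨h.1, h.2⟩, h.3⟩, h.4⟩, fun h => ⟨h.1.1.1, h.1.1.2, h.1.2, h.2⟩⟩
  rw [hset]
  refine (((isClosed_le ?_ ?_).inter (isClosed_setOf_posSemidef.preimage ?_)).inter
    (isClosed_setOf_posSemidef.preimage ?_)).inter (isClosed_eq ?_ ?_) <;> fun_prop

theorem eq_zero_of_isReachable {Z : Matrix ι ι 𝕜} (hC : C.PosSemidef) (hAC : IsReachable Aᴴ C)
    (hZ : Z.PosSemidef) (hAZ : (A * Z + Z * Aᴴ).PosSemidef) (hZCZ : Z * C * Z = 0) : Z = 0 := by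
  have hZC : Z * C = 0 := by
    have hCZ : C * Z = 0 := mul_eq_zero_of_conjTranspose_mul_mul_eq_zero hC (by
      rwa [hZ.isHermitian.eq])
    simpa [hZ.isHermitian.eq, hC.isHermitian.eq] using congrArg conjTranspose hCZ
  have hker : LinearMap.ker Z.mulVecLin = ⊤ := by
    refine hAC _ (fun v hv => ?_) fun u => ?_
    · have hv : Z *ᵥ v = 0 := hv
      have hv' : star v ᵥ* Z = 0 := star_vecMul_eq_zero hZ.isHermitian hv
      have hsum : (A * Z + Z * Aᴴ) *ᵥ v = 0 := by
        refine (hAZ.dotProduct_mulVec_zero_iff v).mp ?_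
        simp [add_mulVec, ← mulVec_mulVec, hv, dotProduct_mulVec _ Z, hv']
      simpa [add_mulVec, ← mulVec_mulVec, hv] using hsum
    · simp [hZC]
  exact ext_iff_mulVec.mpr fun v => by simpa using hker.ge (Submodule.mem_top (x := v))

theorem exists_isHomogeneousSolution_iff (hC : C.PosSemidef) (hAC : IsReachable Aᴴ C)
    (hP : P.PosDef) :
    (∃ z ≠ 0, IsHomogeneousSolution A C P z) ↔ ∃ S : Matrix ι ι 𝕜, S.PosDef ∧
      riccatiMap A C S = P := by
  constructor
  · rintro ⟨⟨s, Z⟩, hne, hs, hZ, hQ, hZCZ⟩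
    have hs : 0 < s := by
      refine hs.lt_of_ne' ?_
      rintro rfl
      simp only [zero_smul, add_zero] at hQ hZCZ
      exact hne (Prod.ext rfl (eq_zero_of_isReachable hC hAC hZ hQ hZCZ))
    have hric : riccatiMap A C (s⁻¹ • Z) = P := by
      simp only [riccatiMap, Matrix.mul_smul, Matrix.smul_mul, hZCZ, inv_smul_smul₀ hs.ne',
        smul_add]
      abel
    exact ⟨s⁻¹ • Z, posDef_of_posDef_riccatiMap (hZ.smul (inv_nonneg.mpr hs.le)) (hric ▸ hP), hric⟩
  · rintro ⟨S, hS, rfl⟩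
    have hlyap : A * S + S * Aᴴ + (1 : ℝ) • riccatiMap A C S = S * C * S := by
      rw [riccatiMap, one_smul]; abel
    refine ⟨(1, S), by simp, zero_le_one, hS.posSemidef, ?_, ?_⟩
    · rw [hlyap]
      simpa [hS.isHermitian.eq] using hC.conjTranspose_mul_mul_same S
    · rw [hlyap, one_smul]

theorem isClosed_setOf_exists_ne_zero_mem {X E : Type*} [TopologicalSpace X]
    [NormedAddCommGroup E] [NormedSpace ℝ E] [ProperSpace E] {K : Set (X × E)} (hK : IsClosed K)
    (hcone : ∀ x e, (x, e) ∈ K → ∀ t : ℝ, 0 ≤ t → (x, t • e) ∈ K) :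
    IsClosed {x | ∃ e ≠ 0, (x, e) ∈ K} := by
  have himage : {x | ∃ e ≠ 0, (x, e) ∈ K} =
      Prod.fst '' {y : X × Metric.sphere (0 : E) 1 | (y.1, (y.2 : E)) ∈ K} := by
    ext x
    constructor
    · rintro ⟨e, he, hxe⟩
      exact ⟨(x, ⟨‖e‖⁻¹ • e, by simp [norm_smul, he]⟩),
        hcone x e hxe _ (inv_nonneg.mpr (norm_nonneg e)), rfl⟩
    · rintro ⟨⟨x, e⟩, hxe, rfl⟩
      exact ⟨e, ne_zero_of_mem_unit_sphere e, hxe⟩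
  rw [himage]
  exact isClosedMap_fst_of_compactSpace _ (hK.preimage (by fun_prop))

theorem isClosed_setOf_exists_riccatiMap_eq {X : Type*} [TopologicalSpace X]
    {a c q : X → Matrix ι ι 𝕜} (ha : Continuous a) (hc : Continuous c) (hq : Continuous q)
    (hC : ∀ x, (c x).PosSemidef) (hAC : ∀ x, IsReachable (a x)ᴴ (c x)) (hP : ∀ x, (q x).PosDef) :
    IsClosed {x | ∃ S : Matrix ι ι 𝕜, S.PosDef ∧ riccatiMap (a x) (c x) S = q x} := by
  have hK : IsClosed {y : X × (ℝ × Matrix ι ι 𝕜) |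
      IsHomogeneousSolution (a y.1) (c y.1) (q y.1) y.2} :=
    isClosed_setOf_isHomogeneousSolution.preimage
      (by fun_prop : Continuous fun y : X × (ℝ × Matrix ι ι 𝕜) => ((a y.1, c y.1, q y.1), y.2))
  simp only [← exists_isHomogeneousSolution_iff (hC _) (hAC _) (hP _)]
  have : FiniteDimensional ℝ (Matrix ι ι 𝕜) := inferInstance
  open scoped Matrix.Norms.Operator in
  have : ProperSpace (ℝ × Matrix ι ι 𝕜) := FiniteDimensional.proper ℝ _
  open scoped Matrix.Norms.Operator in
  exact isClosed_setOf_exists_ne_zero_mem hK fun x z hz t ht => hz.smul ht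

theorem exists_riccatiMap_eq_of_preconnectedSpace {X : Type*} [TopologicalSpace X]
    [PreconnectedSpace X] {a c q : X → Matrix ι ι 𝕜} (ha : Continuous a) (hc : Continuous c)
    (hq : Continuous q) (hC : ∀ x, (c x).PosSemidef) (hAC : ∀ x, IsReachable (a x)ᴴ (c x))
    (hP : ∀ x, (q x).PosDef) {x₀ : X}
    (h₀ : ∃ S : Matrix ι ι 𝕜, S.PosDef ∧ riccatiMap (a x₀) (c x₀) S = q x₀) (x : X) :
    ∃ S : Matrix ι ι 𝕜, S.PosDef ∧ riccatiMap (a x) (c x) S = q x := by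
  have hclosed := isClosed_setOf_exists_riccatiMap_eq ha hc hq hC hAC hP
  have hopen : IsOpen {x | ∃ S : Matrix ι ι 𝕜, S.PosDef ∧ riccatiMap (a x) (c x) S = q x} := by
    refine isOpen_iff_mem_nhds.mpr fun x ⟨S, hS, hx⟩ => ?_
    have hevent := eventually_exists_riccatiMap_eq (hC x) hS (hx ▸ hP x) univ_mem
    rw [hx] at hevent
    have hcont : Continuous fun y => (a y, c y, q y) := by fun_prop
    filter_upwards [hcont.continuousAt.eventually hevent] with y hy
    obtain ⟨T, -, hT⟩ := hy (hC y).isHermitian (hP y).isHermitian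
    exact ⟨T, hT⟩
  exact (IsClopen.eq_univ ⟨hclosed, hopen⟩ ⟨x₀, h₀⟩).ge (Set.mem_univ x)

theorem exists_posDef_riccatiMap_eq (hC : C.PosSemidef) (hAC : IsReachable Aᴴ C) (hP : P.PosDef) :
    ∃ S : Matrix ι ι 𝕜, S.PosDef ∧ riccatiMap A C S = P := by
  classical
  have : PreconnectedSpace {Q : Matrix ι ι 𝕜 // Q.PosDef} :=
    isPreconnected_iff_preconnectedSpace.mp convex_setOf_posDef.isPreconnected
  have hH : (C - A - Aᴴ).IsHermitian := by
    rw [IsHermitian, conjTranspose_sub, conjTranspose_sub, conjTranspose_conjTranspose,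
      hC.isHermitian.eq, sub_right_comm]
  obtain ⟨s, hs⟩ := exists_posDef_add_smul_one hH
  have hstart : riccatiMap (A - (s / 2) • (1 : Matrix ι ι 𝕜)) C 1
      = C - A - Aᴴ + s • (1 : Matrix ι ι 𝕜) := by
    simp only [riccatiMap, Matrix.one_mul, Matrix.mul_one, conjTranspose_sub, conjTranspose_smul,
      conjTranspose_one, star_trivial]
    module
  have hcont := exists_riccatiMap_eq_of_preconnectedSpace
    (X := ℝ × {Q : Matrix ι ι 𝕜 // Q.PosDef}) (a := fun x => A - x.1 • (1 : Matrix ι ι 𝕜))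
    (c := fun _ => C) (q := fun x => x.2) (x₀ := (s / 2, ⟨_, hs⟩))
    (by fun_prop) (by fun_prop) (by fun_prop) (fun _ => hC) (fun x => ?_) (fun x => x.2.2)
    ⟨1, .one, hstart⟩ (0, ⟨P, hP⟩)
  · simpa using hcont
  · simpa using hAC.sub_smul_one (x.1 : 𝕜)

end Continuation

section Controllability

variable {R R' : Type*} [CommRing R] [CommRing R'] {κ : Type*} [Fintype κ] {n m p : ℕ}

/-- The discrete controllability Gramian `∑ k < n, (A ^ k * B) * (A ^ k * B)ᵀ`, the Gram matrix of
the rows of the controllability matrix. It makes sense over any commutative ring, in particular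
over a ring of polynomials. -/
def controllabilityGramian (A : Matrix (Fin n) (Fin n) R) (B : Matrix (Fin n) κ R) :
    Matrix (Fin n) (Fin n) R :=
  ∑ k : Fin n, A ^ (k : ℕ) * B * (A ^ (k : ℕ) * B)ᵀ

theorem map_controllabilityGramian (f : R →+* R') (A : Matrix (Fin n) (Fin n) R)
    (B : Matrix (Fin n) κ R) :
    (controllabilityGramian A B).map f = controllabilityGramian (A.map f) (B.map f) := by
  have hpow (M : Matrix (Fin n) (Fin n) R) (k : ℕ) : (M ^ k).map f = M.map f ^ k :=
    map_pow f.mapMatrix M k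
  change f.mapMatrix (controllabilityGramian A B) = _
  simp [controllabilityGramian, Matrix.map_mul, ← transpose_map, hpow]

theorem isReachable_of_isUnit_controllabilityGramian {A : Matrix (Fin n) (Fin n) R}
    {B : Matrix (Fin n) κ R} (h : IsUnit (controllabilityGramian A B)) : IsReachable A B := by
  intro W hA hB
  have hpow (k : ℕ) : ∀ v ∈ W, A ^ k *ᵥ v ∈ W := by
    induction k with
    | zero => simp
    | succ k ih => exact fun v hv => by simpa [pow_succ, ← mulVec_mulVec] using ih _ (hA v hv)
  refine eq_top_iff.mpr fun v _ => ?_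
  obtain ⟨w, rfl⟩ := mulVec_surjective_iff_isUnit.mpr h v
  simp only [controllabilityGramian, sum_mulVec, ← mulVec_mulVec]
  exact W.sum_mem fun k _ => hpow k _ (hB _)

theorem rank_eq_card_iff_isUnit {ι K : Type*} [Fintype ι] [DecidableEq ι] [Field K]
    {M : Matrix ι ι K} : M.rank = Fintype.card ι ↔ IsUnit M := by
  rw [← linearIndependent_rows_iff_isUnit, linearIndependent_iff_card_eq_finrank_span,
    rank_eq_finrank_span_row, Set.finrank, eq_comm]

theorem controllabilityMatrix_mul_transpose (A : Matrix (Fin n) (Fin n) ℝ)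
    (B : Matrix (Fin n) (Fin m) ℝ) :
    controllabilityMatrix A B * (controllabilityMatrix A B)ᵀ = controllabilityGramian A B := by
  ext i j
  simp only [controllabilityGramian, controllabilityMatrix, Matrix.mul_apply, Matrix.sum_apply,
    transpose_apply, of_apply, Fintype.sum_prod_type]

theorem isControllablePair_iff_isUnit {A : Matrix (Fin n) (Fin n) ℝ}
    {B : Matrix (Fin n) (Fin m) ℝ} :
    IsControllablePair A B ↔ IsUnit (controllabilityGramian A B) := by
  rw [IsControllablePair, ← rank_self_mul_transpose, controllabilityMatrix_mul_transpose,
    ← rank_eq_card_iff_isUnit, Fintype.card_fin]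

theorem isControllablePair_iff_det_ne_zero {A : Matrix (Fin n) (Fin n) ℝ}
    {B : Matrix (Fin n) (Fin m) ℝ} :
    IsControllablePair A B ↔ (controllabilityGramian A B).det ≠ 0 := by
  rw [isControllablePair_iff_isUnit, isUnit_iff_isUnit_det, isUnit_iff_ne_zero]

theorem isControllablePair_transpose_iff {A : Matrix (Fin n) (Fin n) ℝ}
    {c : Matrix (Fin n) (Fin p) ℝ} : IsControllablePair Aᵀ c ↔ IsObservablePair A c := by
  have htranspose : controllabilityMatrix Aᵀ c = (observabilityMatrix A c)ᵀ := by
    ext i q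
    have hblock : Aᵀ ^ (q.1 : ℕ) * c = (cᵀ * A ^ (q.1 : ℕ))ᵀ := by
      rw [transpose_mul, transpose_pow, transpose_transpose]
    exact congrFun₂ hblock i q.2
  rw [IsControllablePair, IsObservablePair, htranspose, rank_transpose]

theorem isOpen_setOf_isControllablePair :
    IsOpen {x : Matrix (Fin n) (Fin n) ℝ × Matrix (Fin n) (Fin m) ℝ |
      IsControllablePair x.1 x.2} := by
  simp only [isControllablePair_iff_det_ne_zero, controllabilityGramian]
  exact isOpen_ne_fun (by fun_prop) continuous_const

theorem isOpen_setOf_isObservablePair :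
    IsOpen {x : Matrix (Fin n) (Fin n) ℝ × Matrix (Fin n) (Fin p) ℝ |
      IsObservablePair x.1 x.2} := by
  simp only [← isControllablePair_transpose_iff]
  exact isOpen_setOf_isControllablePair.preimage
    (by fun_prop : Continuous fun x : Matrix (Fin n) (Fin n) ℝ × Matrix (Fin n) (Fin p) ℝ =>
      (x.1ᵀ, x.2))

open Polynomial in
theorem finite_setOf_not_isControllablePair {M : Matrix (Fin n) (Fin n) ℝ[X]}
    {N : Matrix (Fin n) (Fin m) ℝ[X]} {t₁ : ℝ}
    (h : IsControllablePair (M.map (eval t₁)) (N.map (eval t₁))) :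
    {t | ¬ IsControllablePair (M.map (eval t)) (N.map (eval t))}.Finite := by
  have hdet (t : ℝ) : (controllabilityGramian (M.map (eval t)) (N.map (eval t))).det
      = (controllabilityGramian M N).det.eval t := by
    rw [← coe_evalRingHom, ← map_controllabilityGramian, RingHom.map_det]
    rfl
  simp only [isControllablePair_iff_det_ne_zero, hdet, not_not] at h ⊢
  exact finite_setOfPred_isRoot fun hzero => h (by rw [hzero, eval_zero])

theorem eventually_isControllablePair_affine {A D : Matrix (Fin n) (Fin n) ℝ}
    {B E : Matrix (Fin n) (Fin m) ℝ} {t₁ : ℝ}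
    (h : IsControllablePair (A + t₁ • D) (B + t₁ • E)) (t₀ : ℝ) :
    ∀ᶠ t in 𝓝[≠] t₀, IsControllablePair (A + t • D) (B + t • E) := by
  have heval {κ : Type} (G H : Matrix (Fin n) κ ℝ) (t : ℝ) :
      (G.map Polynomial.C + (Polynomial.X : Polynomial ℝ) • H.map Polynomial.C).map
        (Polynomial.eval t) = G + t • H := by
    ext i j
    simp only [map_apply, Matrix.add_apply, Matrix.smul_apply, smul_eq_mul, Polynomial.eval_add,
      Polynomial.eval_mul, Polynomial.eval_C, Polynomial.eval_X]
  simp only [← heval] at h ⊢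
  exact nhdsNE_le_cofinite t₀ (mem_cofinite.mpr (finite_setOf_not_isControllablePair h))

theorem IsObservablePair.isReachable {A : Matrix (Fin n) (Fin n) ℝ}
    {c : Matrix (Fin n) (Fin p) ℝ} (h : IsObservablePair A c) : IsReachable Aᴴ (c * cᴴ) := by
  rw [conjTranspose_eq_transpose_of_trivial]
  refine IsReachable.mul_conjTranspose (isReachable_of_isUnit_controllabilityGramian ?_)
  exact isControllablePair_iff_isUnit.mp (isControllablePair_transpose_iff.mpr h)

end Controllability

section RegularTriplets

variable {n p : ℕ}

theorem isPosDefRiccatiSolution_iff {A P S : Matrix (Fin n) (Fin n) ℝ}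
    {c : Matrix (Fin n) (Fin p) ℝ} {r : ℝ} :
    IsPosDefRiccatiSolution A c P r S ↔ S.PosDef ∧ riccatiMap A (r • (c * cᵀ)) S = P := by
  refine and_congr_right fun _ => ?_
  have hneg : A * S + S * Aᵀ - r • (S * c * cᵀ * S) + P
      = -(riccatiMap A (r • (c * cᵀ)) S - P) := by
    rw [riccatiMap, conjTranspose_eq_transpose_of_trivial, Matrix.mul_smul, Matrix.smul_mul,
      ← Matrix.mul_assoc S c]
    abel
  rw [hneg, neg_eq_zero, sub_eq_zero]

theorem posSemidef_smul_mul_transpose {ι κ : Type*} [Finite ι] [Fintype κ] (B : Matrix ι κ ℝ)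
    {r : ℝ} (hr : 0 ≤ r) : (r • (B * Bᵀ)).PosSemidef :=
  (posSemidef_self_mul_conjTranspose B).smul hr

theorem mem_regularTriplets_iff
    {x : Matrix (Fin n) (Fin n) ℝ × Matrix (Fin n) (Fin p) ℝ × Matrix (Fin n) (Fin n) ℝ} :
    x ∈ regularTriplets n p ↔ x ∈ observableTriplets n p ∧ ∃ r : ℝ, 0 < r ∧
      ∃ S, S.PosDef ∧ riccatiMap x.1 (r • (x.2.1 * x.2.1ᵀ)) S = x.2.2 ∧
        IsControllablePair x.1 (S * x.2.1) := by
  simp only [regularTriplets, Set.mem_ofPred_eq, isPosDefRiccatiSolution_iff]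
  refine and_congr_right fun hx => exists_congr fun r => and_congr_right fun hr =>
    exists_congr fun S => ⟨fun ⟨⟨hS, hric⟩, _, hctrl⟩ => ⟨hS, hric, hctrl⟩,
      fun ⟨hS, hric, hctrl⟩ => ⟨⟨hS, hric⟩, fun T ⟨hT, hTric⟩ => ?_, hctrl⟩⟩
  exact eq_of_riccatiMap_eq (posSemidef_smul_mul_transpose _ hr.le) hS hT (hric ▸ hx.2)
    (hTric.trans hric.symm)

theorem isOpen_regularTriplets :
    IsOpen {x : observableTriplets n p | x.1 ∈ regularTriplets n p} := by
  refine isOpen_iff_mem_nhds.mpr fun ⟨(A, c, P), hx⟩ hreg => ?_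
  obtain ⟨-, r, hr, S, hS, hric, hctrl⟩ := mem_regularTriplets_iff.mp hreg
  have hpair : Tendsto (fun y : (Matrix (Fin n) (Fin n) ℝ × Matrix (Fin n) (Fin p) ℝ) ×
      Matrix (Fin n) (Fin n) ℝ => (y.1.1, y.2 * y.1.2)) (𝓝 (A, c) ×ˢ 𝓝 S) (𝓝 (A, S * c)) := by
    rw [← nhds_prod_eq]
    exact (by fun_prop : Continuous _).tendsto _
  obtain ⟨hAc, hAcmem, hU, hUmem, hcontrollable⟩ := eventually_prod_iff.mp
    (hpair.eventually (isOpen_setOf_isControllablePair.mem_nhds hctrl))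
  have hsolution := eventually_exists_riccatiMap_eq (posSemidef_smul_mul_transpose c hr.le) hS
    (hric ▸ hx.2) hUmem
  rw [hric] at hsolution
  have hparam : Continuous fun x : observableTriplets n p =>
      (x.1.1, r • (x.1.2.1 * x.1.2.1ᵀ), x.1.2.2) := by fun_prop
  have hfst : Continuous fun x : observableTriplets n p => (x.1.1, x.1.2.1) := by fun_prop
  filter_upwards [hparam.continuousAt.eventually hsolution,
    hfst.continuousAt.eventually hAcmem] with x hxsol hxAc
  obtain ⟨T, hTU, hT, hTric⟩ := hxsol (posSemidef_smul_mul_transpose _ hr.le).isHermitian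
    x.2.2.isHermitian
  exact mem_regularTriplets_iff.mpr ⟨x.2, r, hr, T, hT, hTric, hcontrollable hxAc hTU⟩

theorem eventually_mem_regularTriplets {A S : Matrix (Fin n) (Fin n) ℝ}
    {c : Matrix (Fin n) (Fin p) ℝ} (hAc : IsObservablePair A c) (hS : S.PosDef)
    (hP : (riccatiMap A (c * cᵀ) S).PosDef) :
    ∀ᶠ t : ℝ in 𝓝[≠] 0,
      (A + t • (Aᵀ - A), c, riccatiMap (A + t • (Aᵀ - A)) (c * cᵀ) (S + t • (1 - S)))
        ∈ regularTriplets n p := by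
  have hC : (c * cᵀ).IsHermitian := isHermitian_mul_conjTranspose_self c
  have hσ (t : ℝ) : (S + t • (1 - S)).IsHermitian :=
    hS.isHermitian.add ((isHermitian_one.sub hS.isHermitian).smul (.all t))
  have hobs : ∀ᶠ t : ℝ in 𝓝 0, IsObservablePair (A + t • (Aᵀ - A)) c :=
    (by fun_prop : Continuous fun t : ℝ => (A + t • (Aᵀ - A), c)).tendsto' 0 (A, c) (by simp)
      (isOpen_setOf_isObservablePair.mem_nhds hAc)
  have hSpos : ∀ᶠ t : ℝ in 𝓝 0, (S + t • (1 - S)).IsHermitian → (S + t • (1 - S)).PosDef :=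
    (by fun_prop : Continuous fun t : ℝ => S + t • (1 - S)).tendsto' 0 S (by simp)
      (eventually_posDef hS)
  have hPpos : ∀ᶠ t : ℝ in 𝓝 0,
      (riccatiMap (A + t • (Aᵀ - A)) (c * cᵀ) (S + t • (1 - S))).IsHermitian →
        (riccatiMap (A + t • (Aᵀ - A)) (c * cᵀ) (S + t • (1 - S))).PosDef :=
    (continuous_riccatiMap.comp (by fun_prop : Continuous fun t : ℝ =>
      (A + t • (Aᵀ - A), c * cᵀ, S + t • (1 - S)))).tendsto' 0 _ (by simp) (eventually_posDef hP)
  have hctrl : ∀ᶠ t : ℝ in 𝓝[≠] 0,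
      IsControllablePair (A + t • (Aᵀ - A)) (S * c + t • ((1 - S) * c)) := by
    refine eventually_isControllablePair_affine (t₁ := 1) ?_ 0
    rw [one_smul, one_smul, add_sub_cancel, ← Matrix.add_mul, add_sub_cancel, Matrix.one_mul]
    exact isControllablePair_transpose_iff.mpr hAc
  filter_upwards [hobs.filter_mono nhdsWithin_le_nhds, hSpos.filter_mono nhdsWithin_le_nhds,
    hPpos.filter_mono nhdsWithin_le_nhds, hctrl] with t htobs htS htP htctrl
  refine mem_regularTriplets_iff.mpr ⟨⟨htobs, htP ?_⟩, 1, one_pos, _, htS (hσ t), ?_, ?_⟩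
  · change _ᴴ = _
    rw [← riccatiMap_conjTranspose hC, (hσ t).eq]
  · rw [one_smul]
  · simpa only [Matrix.add_mul, Matrix.smul_mul] using htctrl

theorem dense_regularTriplets :
    Dense {x : observableTriplets n p | x.1 ∈ regularTriplets n p} := by
  refine Subtype.dense_iff.mpr fun (A, c, P) ⟨(hAc : IsObservablePair A c), hP⟩ => ?_
  have hcc : (c * cᵀ).PosSemidef := posSemidef_self_mul_conjTranspose c
  obtain ⟨S, hS, rfl : _ = P⟩ := exists_posDef_riccatiMap_eq hcc hAc.isReachable hP
  have hpath : Tendsto (fun t : ℝ => (A + t • (Aᵀ - A), c,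
      riccatiMap (A + t • (Aᵀ - A)) (c * cᵀ) (S + t • (1 - S)))) (𝓝[≠] 0)
      (𝓝 (A, c, riccatiMap A (c * cᵀ) S)) := by
    refine Tendsto.mono_left (Continuous.tendsto' ?_ _ _ (by simp)) nhdsWithin_le_nhds
    have hcont := continuous_riccatiMap (ι := Fin n) (R := ℝ)
    fun_prop
  refine mem_closure_of_tendsto hpath ?_
  filter_upwards [eventually_mem_regularTriplets hAc hS hP] with t ht
  exact ⟨⟨_, (mem_regularTriplets_iff.mp ht).1⟩, ht, rfl⟩

end RegularTriplets

theorem mainTheorem7 (n p : ℕ) :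
    IsOpen {x : observableTriplets n p | x.1 ∈ regularTriplets n p} ∧
      Dense {x : observableTriplets n p | x.1 ∈ regularTriplets n p} :=
  ⟨isOpen_regularTriplets, dense_regularTriplets⟩
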